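/- Let $N\ge 1$, $s\in(0,1)$, $p\in(1,\infty)$, and let $\Omega\subset\mathbb{R}^N$ be a bounded open set, with $\rho(x):=\operatorname{dist}(x,\partial\Omega)$. Put $p_s^*:=\frac{Np}{N-sp}$ if $sp<N$ and $p_s^*:=\infty$ (so $1/p_s^*=0$) otherwise. Let $W_0^{s,p}(\Omega)$ be the space of all $u\in W^{s,p}(\mathbb{R}^N)$ with $u=0$ a.e. in $\mathbb{R}^N\setminus\Omega$, with the norm $$\|u\|:=\Big(\int_{\mathbb{R}^{2N}}\frac{|u(x)-u(y)|^p}{|x-y|^{N+sp}}\,dx\,dy\Big)^{1/p}.$$ Let $h$ belong to the class $\widetilde{\mathscr W}_p$, that is, $h$ is measurable on $\Omega$ and $h\rho^{sa}\in L^r(\Omega)$ for some $a\in[0,1]$ and $r\in(1,\infty)$ with $\frac1r+\frac ap+\frac{p-a}{p_s^*}<1$; assume that $|\{x\in\Omega: h(x)>0\}|>0$ ($h$ may change sign). A real number $\lambda$ is an eigenvalue, and $u$ an eigenfunction associated with it, if $u\in W_0^{s,p}(\Omega)$, $u\not\equiv0$, $\lambda h|u|^{p-2}u$ belongs to the dual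 of $W_0^{s,p}(\Omega)$ (i.e. $v\mapsto\int_\Omega \lambda h|u|^{p-2}uv\,dx$ is well defined by absolutely convergent integrals and bounded on $W_0^{s,p}(\Omega)$), and $$\int_{\mathbb{R}^{2N}}\frac{|u(x)-u(y)|^{p-2}(u(x)-u(y))(v(x)-v(y))}{|x-y|^{N+sp}}\,dx\,dy=\lambda\int_\Omega h|u|^{p-2}uv\,dx\qquad\text{for all } v\in W_0^{s,p}(\Omega).$$ Let $$\lambda_1:=\inf\Big\{\|u\|^p:\ u\in W_0^{s,p}(\Omega),\ \int_\Omega h|u|^p\,dx=1\Big\}.$$ If $u$ is an eigenfunction associated with an eigenvalue $\lambda>\lambda_1$, then $u$ must be sign-changing, i.e. $u_+:=\max\{u,0\}\not\equiv0$ and $u_-:=\max\{-u,0\}\not\equiv0$ in $\Omega$ (neither vanishes a.e. in $\Omega$). -/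

import Mathlib

open MeasureTheory
open scoped ENNReal

namespace FracPLap

noncomputable section

/-- Euclidean space `ℝ^N`. -/
abbrev E (N : ℕ) : Type := EuclideanSpace ℝ (Fin N)

/-- The Gagliardo energy density `|u(x) - u(y)|^p / |x - y|^(N + s p)` on `ℝ^N × ℝ^N`. -/
def gagliardoDensity {N : ℕ} (s p : ℝ) (u : E N → ℝ) (z : E N × E N) : ℝ :=
  |u z.1 - u z.2| ^ p / ‖z.1 - z.2‖ ^ ((N : ℝ) + s * p)

/-- `u ∈ W^{s,p}(ℝ^N)`: `u` is in `L^p(ℝ^N)` and its Gagliardo seminorm is finite. -/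
def MemW {N : ℕ} (s p : ℝ) (u : E N → ℝ) : Prop :=
  MemLp u (ENNReal.ofReal p) volume ∧
    Integrable (gagliardoDensity s p u) ((volume : Measure (E N)).prod volume)

/-- `u ∈ W_0^{s,p}(Ω)`: `u ∈ W^{s,p}(ℝ^N)` and `u = 0` (a.e.) in `ℝ^N \ Ω`. -/
def MemW0 {N : ℕ} (Ω : Set (E N)) (s p : ℝ) (u : E N → ℝ) : Prop :=
  MemW s p u ∧ ∀ᵐ x ∂(volume : Measure (E N)), x ∉ Ω → u x = 0

/-- The Gagliardo norm of `W_0^{s,p}(Ω)`. -/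
def gagliardoNorm {N : ℕ} (s p : ℝ) (u : E N → ℝ) : ℝ :=
  (∫ z, gagliardoDensity s p u z ∂((volume : Measure (E N)).prod volume)) ^ (1 / p)

/-- The duality pairing `⟨A(u), v⟩` for the fractional `p`-Laplacian `A`. -/
def pairingA {N : ℕ} (s p : ℝ) (u v : E N → ℝ) : ℝ :=
  ∫ z, |u z.1 - u z.2| ^ (p - 2) * (u z.1 - u z.2) * (v z.1 - v z.2) /
      ‖z.1 - z.2‖ ^ ((N : ℝ) + s * p) ∂((volume : Measure (E N)).prod volume)

/-- `g ∈ W_0^{-s,p'}(Ω)`, the dual space of `W_0^{s,p}(Ω)`: the map `v ↦ ∫_Ω g v` is a well-defined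
(the integrals converge absolutely) and bounded linear functional on `W_0^{s,p}(Ω)`. -/
def MemDual {N : ℕ} (Ω : Set (E N)) (s p : ℝ) (g : E N → ℝ) : Prop :=
  (∀ v : E N → ℝ, MemW0 Ω s p v → IntegrableOn (fun x => g x * v x) Ω volume) ∧
    ∃ C : ℝ, ∀ v : E N → ℝ, MemW0 Ω s p v →
      |∫ x in Ω, g x * v x| ≤ C * gagliardoNorm s p v

/-- `u` is a weak solution of `(-Δ)_p^s u = f(x,u)` in `Ω`, `u = 0` in `ℝ^N \ Ω`. -/
def IsWeakSolution {N : ℕ} (Ω : Set (E N)) (s p : ℝ) (f : E N → ℝ → ℝ) (u : E N → ℝ) : Prop :=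
  MemW0 Ω s p u ∧ MemDual Ω s p (fun x => f x (u x)) ∧
    ∀ v : E N → ℝ, MemW0 Ω s p v → pairingA s p u v = ∫ x in Ω, f x (u x) * v x

/-- `u` is an eigenfunction corresponding to the eigenvalue `lam` for the weight `h`: a nontrivial
weak solution of `(-Δ)_p^s u = lam h |u|^{p-2} u` in `Ω`, `u = 0` in `ℝ^N \ Ω`. -/
def IsEigenfunction {N : ℕ} (Ω : Set (E N)) (s p : ℝ) (h : E N → ℝ) (lam : ℝ)
    (u : E N → ℝ) : Prop :=
  IsWeakSolution Ω s p (fun x t => lam * h x * (|t| ^ (p - 2) * t)) u ∧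
    ¬ u =ᵐ[(volume : Measure (E N))] 0

/-- `lam` is an eigenvalue for the weight `h`. -/
def IsEigenvalue {N : ℕ} (Ω : Set (E N)) (s p : ℝ) (h : E N → ℝ) (lam : ℝ) : Prop :=
  ∃ u : E N → ℝ, IsEigenfunction Ω s p h lam u

/-- `λ₁ = inf {‖u‖^p : u ∈ W_0^{s,p}(Ω), ∫_Ω h |u|^p = 1}`. The integral can equal `1` only if
it converges absolutely. -/
def lambda1 {N : ℕ} (Ω : Set (E N)) (s p : ℝ) (h : E N → ℝ) : ℝ :=
  sInf {t : ℝ | ∃ u : E N → ℝ, MemW0 Ω s p u ∧ ∫ x in Ω, h x * |u x| ^ p = 1 ∧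
    t = gagliardoNorm s p u ^ p}

/-- The critical exponent `p_s^* = N p / (N - s p)` if `s p < N`, and `∞` otherwise. -/
def criticalExponent (N : ℕ) (s p : ℝ) : ℝ≥0∞ :=
  if s * p < N then ENNReal.ofReal (N * p / (N - s * p)) else ∞

/-- The distance `ρ(x) = dist(x, ∂Ω)`. -/
def rho {N : ℕ} (Ω : Set (E N)) (x : E N) : ℝ := Metric.infDist x (frontier Ω)

/-- The weight class `W̃_q` (for `1 ≤ q < p_s^*`): measurable `h` with `h ρ^{s a} ∈ L^r(Ω)` for
some `a ∈ [0,1]` and `r ∈ (1,∞)` with `1/r + a/p + (max{p,q} - a)/p_s^* < 1`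
(where `1/p_s^* = 0` if `p_s^* = ∞`). -/
def MemWTilde {N : ℕ} (Ω : Set (E N)) (s p q : ℝ) (h : E N → ℝ) : Prop :=
  AEMeasurable h (volume.restrict Ω) ∧
    ∃ a r : ℝ, 0 ≤ a ∧ a ≤ 1 ∧ 1 < r ∧
      1 / r + a / p + (max p q - a) * ((criticalExponent N s p)⁻¹).toReal < 1 ∧
      MemLp (fun x => h x * rho Ω x ^ (s * a)) (ENNReal.ofReal r) (volume.restrict Ω)

/-- `u` is sign-changing in `Ω`: `u_+ ≢ 0` and `u_- ≢ 0` (as classes modulo null sets), where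
`u_+ = max{u,0}` and `u_- = max{-u,0}`. -/
def SignChanging {N : ℕ} (Ω : Set (E N)) (u : E N → ℝ) : Prop :=
  ¬ (fun x => max (u x) 0) =ᵐ[volume.restrict Ω] 0 ∧
    ¬ (fun x => max (-u x) 0) =ᵐ[volume.restrict Ω] 0

end

end FracPLap

/-!
An eigenfunction `u` that does not change sign may be taken nonnegative, and it is enough to show
that its eigenvalue `λ` is at most `λ₁` (`IsEigenfunction.le_lambda1_of_nonneg`). The test
functions are always `w ^ p / (u + ε) ^ (p - 1)` with `w ≥ 0` bounded, for which the discrete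
Picone inequality (`picone`, `pairingDensity_picone_le`) bounds the integrand of the pairing with
`u` pointwise by the Gagliardo density of `w`. Picone's inequality is used in two ways.

* With `w` a truncation of `|v|`, where `∫_Ω h |v| ^ p = 1`, the limit `ε → 0` gives
  `λ ∫_{u > 0} h |v| ^ p ≤ ‖v‖ ^ p` (`IsEigenfunction.le_energy`). No minimizer for `λ₁` is needed,
  only that `u > 0` a.e. in `Ω`.
* With `w` a cutoff equal to `1` on a compact set that meets both `{u = 0}` and `{u > 0}` in positive
  measure, the pairing would tend to `-∞` as `ε → 0` although the right-hand side stays bounded,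
  because `h` is locally integrable in `Ω`. This is the strong maximum principle
  (`IsEigenfunction.ae_pos`).

The infimum `λ₁` is over a nonempty set because cutoffs approximate the indicator function of a
compact subset of `{h > 0}` (`exists_integral_weight_eq_one`).
-/

namespace FracPLap

/-! ### Real inequalities -/

theorem abs_rpow_sub_two_mul {p t : ℝ} (hp : 1 < p) (ht : 0 ≤ t) :
    |t| ^ (p - 2) * t = t ^ (p - 1) := by
  rcases ht.eq_or_lt with rfl | ht
  · rw [mul_zero, Real.zero_rpow (by linarith)]
  · rw [abs_of_pos ht, ← Real.rpow_add_one ht.ne']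
    ring_nf

theorem rpow_div_rpow_sub_one {p a c : ℝ} (ha : 0 < a) (hc : 0 ≤ c) :
    c ^ p / a ^ (p - 1) = a * (c / a) ^ p := by
  rw [Real.div_rpow hc ha.le, Real.rpow_sub_one ha.ne']
  have := Real.rpow_pos_of_pos ha p
  field_simp

/-- Picone's inequality for ordered denominators; this is the convexity of `t ↦ t ^ p` applied to
`c / a`, a mean of `d / b` and `(c - d) / (a - b)` with weights `b / a` and `(a - b) / a`. -/
theorem picone_of_lt {p a b c d : ℝ} (hp : 1 < p) (hb : 0 < b) (hab : b < a) (hc : 0 ≤ c)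
    (hd : 0 ≤ d) :
    (a - b) ^ (p - 1) * (c ^ p / a ^ (p - 1) - d ^ p / b ^ (p - 1)) ≤ |c - d| ^ p := by
  have ha : 0 < a := hb.trans hab
  have hab' : 0 < a - b := sub_pos.2 hab
  have hP := Real.rpow_pos_of_pos hab' (p - 1)
  rcases le_total c d with hcd | hcd
  · have h1 : c ^ p / a ^ (p - 1) ≤ d ^ p / b ^ (p - 1) := by gcongr
    exact (mul_nonpos_of_nonneg_of_nonpos hP.le (sub_nonpos.2 h1)).trans (by positivity)
  · have hcd' : 0 ≤ c - d := sub_nonneg.2 hcd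
    have key := (convexOn_rpow hp.le).2 (Set.mem_Ici.2 (by positivity : 0 ≤ d / b))
      (Set.mem_Ici.2 (by positivity : 0 ≤ (c - d) / (a - b))) (by positivity : 0 ≤ b / a)
      (by positivity : 0 ≤ (a - b) / a) (by field_simp; ring)
    simp only [smul_eq_mul] at key
    have e : b / a * (d / b) + (a - b) / a * ((c - d) / (a - b)) = c / a := by
      field_simp; ring
    rw [e] at key
    have h2 : c ^ p / a ^ (p - 1) ≤ d ^ p / b ^ (p - 1) + (c - d) ^ p / (a - b) ^ (p - 1) := by
      rw [rpow_div_rpow_sub_one ha hc, rpow_div_rpow_sub_one hb hd,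
        rpow_div_rpow_sub_one hab' hcd']
      calc a * (c / a) ^ p ≤ a * (b / a * (d / b) ^ p + (a - b) / a * ((c - d) / (a - b)) ^ p) := by
            gcongr
        _ = _ := by field_simp
    rw [abs_of_nonneg hcd']
    calc _ ≤ (a - b) ^ (p - 1) * ((c - d) ^ p / (a - b) ^ (p - 1)) := by
          gcongr; linarith
      _ = _ := by field_simp

/-- The discrete Picone inequality. -/
theorem picone {p a b c d : ℝ} (hp : 1 < p) (ha : 0 < a) (hb : 0 < b) (hc : 0 ≤ c) (hd : 0 ≤ d) :
    |a - b| ^ (p - 2) * (a - b) * (c ^ p / a ^ (p - 1) - d ^ p / b ^ (p - 1)) ≤ |c - d| ^ p := by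
  rcases lt_trichotomy a b with hab | rfl | hab
  · have := picone_of_lt hp ha hab hd hc
    rw [← abs_rpow_sub_two_mul hp (sub_nonneg.2 hab.le), abs_sub_comm b a, abs_sub_comm d c] at this
    linarith
  · simp only [sub_self, mul_zero, zero_mul]; positivity
  · rw [abs_rpow_sub_two_mul hp (sub_nonneg.2 hab.le)]
    exact picone_of_lt hp hb hab hc hd

theorem add_rpow_le_two_rpow_mul {p a b : ℝ} (hp : 0 ≤ p) (ha : 0 ≤ a) (hb : 0 ≤ b) :
    (a + b) ^ p ≤ 2 ^ p * (a ^ p + b ^ p) := by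
  have h1 : (a + b) ^ p ≤ (2 * max a b) ^ p := by
    gcongr; linarith [le_max_left a b, le_max_right a b]
  refine h1.trans ?_
  rw [Real.mul_rpow (by norm_num) (by positivity)]
  gcongr
  have := Real.rpow_nonneg ha p
  have := Real.rpow_nonneg hb p
  rcases max_cases a b with ⟨h, _⟩ | ⟨h, _⟩ <;> rw [h] <;> linarith

theorem rpow_sub_one_mul_le {p a b : ℝ} (hp : 1 < p) (ha : 0 ≤ a) (hb : 0 ≤ b) :
    a ^ (p - 1) * b ≤ a ^ p + b ^ p := by
  have hmul : ∀ {t : ℝ}, 0 ≤ t → t ^ (p - 1) * t = t ^ p := fun {t} ht => by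
    rw [← Real.rpow_add_one' ht (by linarith)]; ring_nf
  have h1 := Real.rpow_nonneg ha p
  have h2 := Real.rpow_nonneg hb p
  rcases le_total a b with h | h
  · have : a ^ (p - 1) * b ≤ b ^ (p - 1) * b := by gcongr
    rw [hmul hb] at this; linarith
  · have : a ^ (p - 1) * b ≤ a ^ (p - 1) * a := by gcongr
    rw [hmul ha] at this; linarith

theorem abs_rpow_sub_rpow_le {p k c d : ℝ} (hp : 1 < p) (hc : 0 ≤ c) (hd : 0 ≤ d) (hck : c ≤ k)
    (hdk : d ≤ k) : |c ^ p - d ^ p| ≤ p * k ^ (p - 1) * |c - d| := by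
  have := (convex_Icc (0 : ℝ) k).norm_image_sub_le_of_norm_hasDerivWithin_le
    (f := fun x : ℝ => x ^ p) (f' := fun x => p * x ^ (p - 1)) (C := p * k ^ (p - 1))
    (fun x hx => (Real.hasDerivAt_rpow_const (Or.inr hp.le)).hasDerivWithinAt)
    (fun x hx => by
      have := Real.rpow_nonneg hx.1 (p - 1)
      rw [Real.norm_eq_abs, abs_of_nonneg (by positivity)]
      have := Real.rpow_le_rpow hx.1 hx.2 (by linarith : 0 ≤ p - 1)
      gcongr) ⟨hd, hdk⟩ ⟨hc, hck⟩
  simpa only [Real.norm_eq_abs] using this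

theorem abs_rpow_neg_sub_rpow_neg_le {q ε a b : ℝ} (hq : 0 < q) (hε : 0 < ε) (ha : ε ≤ a)
    (hb : ε ≤ b) : |a ^ (-q) - b ^ (-q)| ≤ q * ε ^ (-q - 1) * |a - b| := by
  have := (convex_Ici ε).norm_image_sub_le_of_norm_hasDerivWithin_le
    (f := fun x : ℝ => x ^ (-q)) (f' := fun x => -q * x ^ (-q - 1)) (C := q * ε ^ (-q - 1))
    (fun x hx => (Real.hasDerivAt_rpow_const
      (Or.inl (hε.trans_le hx).ne')).hasDerivWithinAt)
    (fun x hx => by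
      have hx0 : 0 < x := hε.trans_le hx
      have := Real.rpow_pos_of_pos hx0 (-q - 1)
      rw [Real.norm_eq_abs, abs_mul, abs_neg, abs_of_pos hq, abs_of_pos this]
      have := Real.rpow_le_rpow_of_nonpos hε hx (by linarith : -q - 1 ≤ 0)
      gcongr) hb ha
  simpa only [Real.norm_eq_abs] using this

/-- On `[0, k] × [0, ∞)` the map `(c, t) ↦ c ^ p / (t + ε) ^ (p - 1)` is Lipschitz. -/
theorem abs_rpow_div_sub_le {p k ε c d a b : ℝ} (hp : 1 < p) (hε : 0 < ε)
    (hc : 0 ≤ c) (hd : 0 ≤ d) (hck : c ≤ k) (hdk : d ≤ k) (ha : 0 ≤ a) (hb : 0 ≤ b) :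
    |c ^ p / (a + ε) ^ (p - 1) - d ^ p / (b + ε) ^ (p - 1)| ≤
      (ε ^ (-(p - 1)) * (p * k ^ (p - 1))) * |c - d| +
      (k ^ p * ((p - 1) * ε ^ (-(p - 1) - 1))) * |a - b| := by
  have ha' : ε ≤ a + ε := by linarith
  have hb' : ε ≤ b + ε := by linarith
  have hk : 0 ≤ k := hc.trans hck
  have h1 := abs_rpow_sub_rpow_le hp hc hd hck hdk
  have h2 := abs_rpow_neg_sub_rpow_neg_le (by linarith : 0 < p - 1) hε ha' hb'
  rw [add_sub_add_right_eq_sub] at h2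
  have e : c ^ p / (a + ε) ^ (p - 1) - d ^ p / (b + ε) ^ (p - 1) =
      (a + ε) ^ (-(p - 1)) * (c ^ p - d ^ p) +
        d ^ p * ((a + ε) ^ (-(p - 1)) - (b + ε) ^ (-(p - 1))) := by
    rw [Real.rpow_neg (by linarith), Real.rpow_neg (by linarith)]; ring
  have h3 : (a + ε) ^ (-(p - 1)) ≤ ε ^ (-(p - 1)) :=
    Real.rpow_le_rpow_of_nonpos hε ha' (by linarith)
  have h4 : d ^ p ≤ k ^ p := by gcongr
  have h5 : 0 ≤ (a + ε) ^ (-(p - 1)) := Real.rpow_nonneg (by linarith) _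
  have h6 : 0 ≤ d ^ p := by positivity
  rw [e]
  refine (abs_add_le _ _).trans (add_le_add ?_ ?_)
  · rw [abs_mul, abs_of_nonneg h5, mul_assoc]
    gcongr
  · rw [abs_mul, abs_of_nonneg h6, mul_assoc]
    gcongr

/-! ### Energy densities and test functions -/

/-- The integrand of `pairingA`. -/
noncomputable def pairingDensity {N : ℕ} (s p : ℝ) (u v : E N → ℝ) (z : E N × E N) : ℝ :=
  |u z.1 - u z.2| ^ (p - 2) * (u z.1 - u z.2) * (v z.1 - v z.2) /
    ‖z.1 - z.2‖ ^ ((N : ℝ) + s * p)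

section Densities

variable {N : ℕ} {s p : ℝ} {u v w : E N → ℝ}

theorem gagliardoDensity_nonneg (z : E N × E N) : 0 ≤ gagliardoDensity s p u z := by
  unfold gagliardoDensity; positivity

theorem aestronglyMeasurable_gagliardoDensity (hu : AEStronglyMeasurable u volume) :
    AEStronglyMeasurable (gagliardoDensity s p u)
      ((volume : Measure (E N)).prod volume) := by
  have hu' := hu.aemeasurable
  have h1 : AEMeasurable (fun z : E N × E N => u z.1) (volume.prod volume) := hu'.comp_fst
  have h2 : AEMeasurable (fun z : E N × E N => u z.2) (volume.prod volume) := hu'.comp_snd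
  have h3 : Measurable fun z : E N × E N => ‖z.1 - z.2‖ ^ ((N : ℝ) + s * p) := by fun_prop
  exact (((h1.sub h2).abs.pow_const p).div h3.aemeasurable).aestronglyMeasurable

theorem aestronglyMeasurable_pairingDensity (hu : AEStronglyMeasurable u volume)
    (hv : AEStronglyMeasurable v volume) :
    AEStronglyMeasurable (pairingDensity s p u v)
      ((volume : Measure (E N)).prod volume) := by
  have h1 : AEMeasurable (fun z : E N × E N => u z.1) (volume.prod volume) :=
    hu.aemeasurable.comp_fst
  have h2 : AEMeasurable (fun z : E N × E N => u z.2) (volume.prod volume) :=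
    hu.aemeasurable.comp_snd
  have h1' : AEMeasurable (fun z : E N × E N => v z.1) (volume.prod volume) :=
    hv.aemeasurable.comp_fst
  have h2' : AEMeasurable (fun z : E N × E N => v z.2) (volume.prod volume) :=
    hv.aemeasurable.comp_snd
  have h3 : Measurable fun z : E N × E N => ‖z.1 - z.2‖ ^ ((N : ℝ) + s * p) := by fun_prop
  exact (((((h1.sub h2).abs.pow_const (p - 2)).mul (h1.sub h2)).mul (h1'.sub h2')).div
    h3.aemeasurable).aestronglyMeasurable

theorem abs_pairingDensity_le (hp : 1 < p) (z : E N × E N) :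
    |pairingDensity s p u v z| ≤ gagliardoDensity s p u z + gagliardoDensity s p v z := by
  unfold pairingDensity gagliardoDensity
  have hK : 0 ≤ ‖z.1 - z.2‖ ^ ((N : ℝ) + s * p) := by positivity
  rw [abs_div, abs_of_nonneg hK, ← add_div]
  refine div_le_div_of_nonneg_right ?_ hK
  rw [abs_mul, abs_mul, abs_of_nonneg (by positivity : 0 ≤ |u z.1 - u z.2| ^ (p - 2))]
  have := abs_rpow_sub_two_mul hp (abs_nonneg (u z.1 - u z.2))
  rw [abs_abs] at this
  rw [this]
  exact rpow_sub_one_mul_le hp (abs_nonneg _) (abs_nonneg _)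

theorem integrable_pairingDensity (hp : 1 < p) (hu : MemW s p u) (hv : MemW s p v) :
    Integrable (pairingDensity s p u v) ((volume : Measure (E N)).prod volume) :=
  (hu.2.add hv.2).mono' (aestronglyMeasurable_pairingDensity hu.1.1 hv.1.1)
    (Filter.Eventually.of_forall fun z => abs_pairingDensity_le hp z)

theorem gagliardoNorm_rpow (hp : 1 < p) :
    gagliardoNorm s p u ^ p =
      ∫ z, gagliardoDensity s p u z ∂((volume : Measure (E N)).prod volume) := by
  unfold gagliardoNorm
  rw [one_div, Real.rpow_inv_rpow (integral_nonneg fun z => gagliardoDensity_nonneg z)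
    (by linarith)]

/-- A function whose increments are controlled by those of two members of `W^{s,p}` has finite
Gagliardo seminorm. -/
theorem integrable_gagliardoDensity_of_le (hp : 1 < p) (hu : MemW s p u) (hw : MemW s p w)
    (hv : AEStronglyMeasurable v volume) {A B : ℝ} (hA : 0 ≤ A) (hB : 0 ≤ B)
    (hle : ∀ x y, |v x - v y| ≤ A * |w x - w y| + B * |u x - u y|) :
    Integrable (gagliardoDensity s p v) ((volume : Measure (E N)).prod volume) := by
  refine (((hw.2.const_mul (A ^ p)).add (hu.2.const_mul (B ^ p))).const_mul (2 ^ p)).mono'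
    (aestronglyMeasurable_gagliardoDensity hv) (Filter.Eventually.of_forall fun z => ?_)
  rw [Real.norm_eq_abs, abs_of_nonneg (gagliardoDensity_nonneg z)]
  have h1 : |v z.1 - v z.2| ^ p ≤
      2 ^ p * (A ^ p * |w z.1 - w z.2| ^ p + B ^ p * |u z.1 - u z.2| ^ p) := by
    rw [← Real.mul_rpow hA (abs_nonneg _), ← Real.mul_rpow hB (abs_nonneg _)]
    exact (Real.rpow_le_rpow (abs_nonneg _) (hle _ _) (by linarith)).trans
      (add_rpow_le_two_rpow_mul (by linarith) (by positivity) (by positivity))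
  have hK : 0 ≤ ‖z.1 - z.2‖ ^ ((N : ℝ) + s * p) := by positivity
  simp only [gagliardoDensity, Pi.add_apply]
  refine (div_le_div_of_nonneg_right h1 hK).trans_eq ?_
  ring

/-- Picone's inequality for the pairing of `u` with the test function `w ^ p / (u + ε) ^ (p - 1)`. -/
theorem pairingDensity_picone_le (hp : 1 < p) {ε : ℝ} (hε : 0 < ε) (hu : ∀ x, 0 ≤ u x)
    (hw : ∀ x, 0 ≤ w x) (z : E N × E N) :
    pairingDensity s p u (fun x => w x ^ p / (u x + ε) ^ (p - 1)) z ≤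
      gagliardoDensity s p w z := by
  unfold pairingDensity gagliardoDensity
  refine div_le_div_of_nonneg_right ?_ (by positivity)
  have := picone hp (add_pos_of_nonneg_of_pos (hu z.1) hε) (add_pos_of_nonneg_of_pos (hu z.2) hε)
    (hw z.1) (hw z.2)
  rwa [add_sub_add_right_eq_sub] at this

/-- The quotients `w ^ p / (u + ε) ^ (p - 1)` with bounded `w` are admissible test functions. -/
theorem memW0_rpow_div {Ω : Set (E N)} (hp : 1 < p) {ε k : ℝ} (hε : 0 < ε) (hu : MemW s p u)
    (hu0 : ∀ x, 0 ≤ u x) (hw : MemW0 Ω s p w) (hw0 : ∀ x, 0 ≤ w x) (hwk : ∀ x, w x ≤ k) :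
    MemW0 Ω s p (fun x => w x ^ p / (u x + ε) ^ (p - 1)) := by
  have hk : 0 ≤ k := (hw0 0).trans (hwk 0)
  have hmeas : AEStronglyMeasurable (fun x => w x ^ p / (u x + ε) ^ (p - 1)) volume :=
    ((hw.1.1.1.aemeasurable.pow_const p).div
      ((hu.1.1.aemeasurable.add_const ε).pow_const (p - 1))).aestronglyMeasurable
  refine ⟨⟨?_, ?_⟩, ?_⟩
  · refine (hw.1.1.const_mul (k ^ (p - 1) / ε ^ (p - 1))).mono hmeas
      (Filter.Eventually.of_forall fun x => ?_)
    have h1 : 0 < u x + ε := add_pos_of_nonneg_of_pos (hu0 x) hε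
    have h2 : w x ^ p = w x ^ (p - 1) * w x := by
      rw [← Real.rpow_add_one' (hw0 x) (by linarith)]; ring_nf
    have h3 : 0 ≤ w x ^ p / (u x + ε) ^ (p - 1) :=
      div_nonneg (Real.rpow_nonneg (hw0 x) _) (by positivity)
    have h4 : 0 ≤ k ^ (p - 1) / ε ^ (p - 1) * w x := mul_nonneg (by positivity) (hw0 x)
    rw [Real.norm_eq_abs, Real.norm_eq_abs, abs_of_nonneg h3, abs_of_nonneg h4, h2,
      div_mul_eq_mul_div]
    have := hw0 x
    have := hwk x
    have := hu0 x
    gcongr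
    linarith
  · refine integrable_gagliardoDensity_of_le hp hu hw.1 hmeas
      (A := ε ^ (-(p - 1)) * (p * k ^ (p - 1)))
      (B := k ^ p * ((p - 1) * ε ^ (-(p - 1) - 1))) (by positivity) ?_ fun x y =>
        abs_rpow_div_sub_le hp hε (hw0 x) (hw0 y) (hwk x) (hwk y) (hu0 x) (hu0 y)
    have : 0 ≤ p - 1 := by linarith
    positivity
  · filter_upwards [hw.2] with x hx hxΩ
    rw [hx hxΩ, Real.zero_rpow (by linarith), zero_div]

/-- Truncation of `|w|` at a nonnegative level keeps `W_0^{s,p}` and does not increase energy. -/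
theorem MemW0.min_abs {Ω : Set (E N)} (hp : 1 < p) (hw : MemW0 Ω s p w) {k : ℝ} (hk : 0 ≤ k) :
    MemW0 Ω s p (fun x => min |w x| k) ∧
      ∫ z, gagliardoDensity s p (fun x => min |w x| k) z ∂((volume : Measure (E N)).prod volume) ≤
        ∫ z, gagliardoDensity s p w z ∂((volume : Measure (E N)).prod volume) := by
  have hmeas : AEStronglyMeasurable (fun x => min |w x| k) volume :=
    (hw.1.1.1.aemeasurable.abs.min aemeasurable_const).aestronglyMeasurable
  have hle : ∀ z : E N × E N, gagliardoDensity s p (fun x => min |w x| k) z ≤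
      gagliardoDensity s p w z := fun z => by
    unfold gagliardoDensity
    have h : |min |w z.1| k - min |w z.2| k| ≤ |w z.1 - w z.2| :=
      (abs_min_sub_min_le_max _ _ _ _).trans (by
        rw [sub_self, abs_zero]
        exact max_le (abs_abs_sub_abs_le _ _) (abs_nonneg _))
    gcongr
  have hint : Integrable (gagliardoDensity s p fun x => min |w x| k)
      ((volume : Measure (E N)).prod volume) :=
    hw.1.2.mono' (aestronglyMeasurable_gagliardoDensity hmeas)
      (Filter.Eventually.of_forall fun z => by
        rw [Real.norm_eq_abs, abs_of_nonneg (gagliardoDensity_nonneg z)]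
        exact hle z)
  refine ⟨⟨⟨hw.1.1.mono hmeas (Filter.Eventually.of_forall fun x => ?_), hint⟩, ?_⟩,
    integral_mono hint hw.1.2 hle⟩
  · rw [Real.norm_eq_abs, abs_of_nonneg (by positivity)]
    exact min_le_left _ _
  · filter_upwards [hw.2] with x hx hxΩ
    rw [hx hxΩ, abs_zero, min_eq_left hk]

theorem MemW0.const_mul {Ω : Set (E N)} (hw : MemW0 Ω s p w) (c : ℝ) :
    MemW0 Ω s p (fun x => c * w x) := by
  refine ⟨⟨hw.1.1.const_mul c, (hw.1.2.const_mul (|c| ^ p)).congr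
    (Filter.Eventually.of_forall fun z => ?_)⟩, ?_⟩
  · simp only [gagliardoDensity]
    rw [← mul_sub, abs_mul, Real.mul_rpow (abs_nonneg _) (abs_nonneg _), mul_div_assoc]
  · filter_upwards [hw.2] with x hx hxΩ
    rw [hx hxΩ, mul_zero]

end Densities

/-! ### Lipschitz cutoffs in `W_0^{s,p}` -/

section Cutoff

/-- The kernel `min (1, L |z|) ^ p / |z| ^ (N + s p)` dominating the Gagliardo density of a cutoff
is integrable: it is `O(|z| ^ (p - N - s p))` at the origin and `O(|z| ^ (- N - s p))` at
infinity. -/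
theorem integrable_min_rpow_div {N : ℕ} (hN : 1 ≤ N) {s p L : ℝ} (hs0 : 0 < s) (hs1 : s < 1)
    (hp : 1 < p) (hL : 0 ≤ L) :
    Integrable (fun z : E N => min 1 (L * ‖z‖) ^ p / ‖z‖ ^ ((N : ℝ) + s * p)) volume := by
  have : Nonempty (Fin N) := ⟨⟨0, hN⟩⟩
  have hsp : 0 < s * p := by positivity
  have hsp' : s * p < p := by nlinarith
  rw [integrable_fun_norm_addHaar (volume : Measure (E N))
    (f := fun t : ℝ => min 1 (L * t) ^ p / t ^ ((N : ℝ) + s * p))]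
  rw [finrank_euclideanSpace_fin]
  have hsimp : ∀ t : ℝ, 0 < t → t ^ (N - 1) • (min 1 (L * t) ^ p / t ^ ((N : ℝ) + s * p)) =
      min 1 (L * t) ^ p * t ^ (-1 - s * p) := fun t ht => by
    rw [smul_eq_mul, ← Real.rpow_natCast, Nat.cast_sub hN, mul_div_left_comm, ← Real.rpow_sub ht]
    congr 2; push_cast; ring
  have hmeas : Measurable fun t : ℝ =>
      t ^ (N - 1) • (min 1 (L * t) ^ p / t ^ ((N : ℝ) + s * p)) := by fun_prop
  have hsplit : Set.Ioi (0 : ℝ) = Set.Ioo 0 2 ∪ Set.Ioi 1 := by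
    ext t; simp only [Set.mem_Ioi, Set.mem_union, Set.mem_Ioo]
    constructor
    · intro h; by_cases h1 : 1 < t
      · exact Or.inr h1
      · exact Or.inl ⟨h, by linarith⟩
    · rintro (h | h) <;> linarith
  rw [hsplit]
  refine IntegrableOn.union ?_ ?_
  · have hI := (intervalIntegral.integrableOn_Ioo_rpow_iff (s := p - 1 - s * p) (t := 2)
      (by norm_num)).2 (by linarith)
    refine Integrable.mono' (hI.const_mul (L ^ p)) hmeas.aestronglyMeasurable ?_
    refine (ae_restrict_iff' measurableSet_Ioo).2 (Filter.Eventually.of_forall fun t ht => ?_)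
    have ht0 : 0 < t := ht.1
    rw [hsimp t ht0, Real.norm_eq_abs, abs_of_nonneg (by positivity)]
    have h1 : min 1 (L * t) ^ p ≤ (L * t) ^ p := by gcongr; exact min_le_right _ _
    calc _ ≤ (L * t) ^ p * t ^ (-1 - s * p) := by gcongr
      _ = _ := by
        rw [Real.mul_rpow hL ht0.le, mul_assoc, ← Real.rpow_add ht0]; ring_nf
  · have hI := integrableOn_Ioi_rpow_of_lt (a := -1 - s * p) (c := 1) (by linarith) one_pos
    refine Integrable.mono' hI hmeas.aestronglyMeasurable ?_
    refine (ae_restrict_iff' measurableSet_Ioi).2 (Filter.Eventually.of_forall fun t ht => ?_)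
    have ht0 : 0 < t := one_pos.trans ht
    rw [hsimp t ht0, Real.norm_eq_abs, abs_of_nonneg (by positivity)]
    have h1 : min 1 (L * t) ^ p ≤ 1 :=
      Real.rpow_le_one (by positivity) (min_le_left _ _) (by linarith)
    calc _ ≤ 1 * t ^ (-1 - s * p) := by gcongr
      _ = _ := one_mul _

/-- Lipschitz functions with values in `[0, 1]` that vanish off a set of finite measure are in
`W^{s,p}`. -/
theorem memW_of_lipschitz {N : ℕ} (hN : 1 ≤ N) {s p : ℝ} (hs0 : 0 < s) (hs1 : s < 1)
    (hp : 1 < p) {f : E N → ℝ} {L : ℝ} (hL : 0 ≤ L) (hf : ∀ x y, |f x - f y| ≤ L * ‖x - y‖)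
    (hfc : Continuous f) (hf0 : ∀ x, 0 ≤ f x) (hf1 : ∀ x, f x ≤ 1) {S : Set (E N)}
    (hS : MeasurableSet S) (hSf : volume S < ∞) (hfS : ∀ x, x ∉ S → f x = 0) : MemW s p f := by
  have hmeas : AEStronglyMeasurable f volume := hfc.aestronglyMeasurable
  set g : E N → ℝ := fun z => min 1 (L * ‖z‖) ^ p / ‖z‖ ^ ((N : ℝ) + s * p) with hg
  have hgi : Integrable g volume := integrable_min_rpow_div hN hs0 hs1 hp hL
  have hg0 : ∀ z, 0 ≤ g z := fun z => by simp only [hg]; positivity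
  have hgneg : ∀ x y : E N, g (y - x) = g (x - y) := fun x y => by
    simp only [hg]; rw [norm_sub_rev]
  have hind : Integrable (S.indicator fun _ => (1 : ℝ)) (volume : Measure (E N)) :=
    (integrable_indicator_iff hS).2 (integrableOn_const hSf.ne)
  have hconv := hind.convolution_integrand (ContinuousLinearMap.mul ℝ ℝ) hgi
  have hconv' := hconv.swap
  refine ⟨?_, (hconv.add hconv').mono' (aestronglyMeasurable_gagliardoDensity hmeas)
    (Filter.Eventually.of_forall fun z => ?_)⟩
  · refine (memLp_indicator_const (ENNReal.ofReal p) hS (1 : ℝ) (Or.inr hSf.ne)).mono hmeas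
      (Filter.Eventually.of_forall fun x => ?_)
    by_cases hx : x ∈ S
    · rw [Set.indicator_of_mem hx, Real.norm_eq_abs, abs_of_nonneg (hf0 x), norm_one]
      exact hf1 x
    · rw [hfS x hx, norm_zero]; positivity
  · rw [Real.norm_eq_abs, abs_of_nonneg (gagliardoDensity_nonneg z)]
    have hle : gagliardoDensity s p f z ≤ g (z.1 - z.2) := by
      simp only [gagliardoDensity, hg]
      have : |f z.1 - f z.2| ≤ min 1 (L * ‖z.1 - z.2‖) :=
        le_min (abs_le.2 ⟨by linarith [hf0 z.1, hf1 z.2], by linarith [hf0 z.2, hf1 z.1]⟩)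
          (hf _ _)
      gcongr
    simp only [Pi.add_apply, Function.comp_apply, Prod.fst_swap, Prod.snd_swap,
      ContinuousLinearMap.mul_apply', hgneg z.1 z.2]
    have hi : ∀ x, 0 ≤ S.indicator (fun _ => (1 : ℝ)) x := fun x =>
      Set.indicator_nonneg (fun _ _ => zero_le_one) x
    have h1 := mul_nonneg (hi z.1) (hg0 (z.1 - z.2))
    have h2 := mul_nonneg (hi z.2) (hg0 (z.1 - z.2))
    by_cases hx : z.1 ∈ S
    · rw [Set.indicator_of_mem hx, one_mul] at *; linarith
    by_cases hy : z.2 ∈ S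
    · rw [Set.indicator_of_mem hy, one_mul] at *; linarith
    · have h0 : gagliardoDensity s p f z = 0 := by
        simp only [gagliardoDensity]
        rw [hfS _ hx, hfS _ hy, sub_zero, abs_zero, Real.zero_rpow (by linarith), zero_div]
      rw [h0]; linarith

/-- The piecewise linear cutoff that equals `1` on `K` and vanishes at distance at least `δ`
from `K`. -/
noncomputable def cutoff {N : ℕ} (K : Set (E N)) (δ : ℝ) (x : E N) : ℝ :=
  max 0 (1 - Metric.infDist x K / δ)

variable {N : ℕ} {K : Set (E N)} {δ : ℝ}

theorem cutoff_nonneg (x : E N) : 0 ≤ cutoff K δ x := le_max_left _ _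

theorem cutoff_le_one (hδ : 0 < δ) (x : E N) : cutoff K δ x ≤ 1 :=
  max_le zero_le_one (sub_le_self _ (div_nonneg Metric.infDist_nonneg hδ.le))

theorem cutoff_of_mem {x : E N} (hx : x ∈ K) : cutoff K δ x = 1 := by
  rw [cutoff, Metric.infDist_zero_of_mem hx, zero_div, sub_zero, max_eq_right zero_le_one]

theorem cutoff_of_notMem_cthickening (hδ : 0 < δ) (hK : K.Nonempty) {x : E N}
    (hx : x ∉ Metric.cthickening δ K) : cutoff K δ x = 0 := by
  rw [Metric.mem_cthickening_iff, not_le, ← ENNReal.ofReal_toReal (Metric.infEDist_ne_top hK)]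
    at hx
  have h := (ENNReal.ofReal_lt_ofReal_iff_of_nonneg hδ.le).1 hx
  rw [cutoff, max_eq_left]
  rw [sub_nonpos, one_le_div hδ]
  exact h.le

theorem continuous_cutoff : Continuous (cutoff K δ) := by
  unfold cutoff
  have := Metric.continuous_infDist_pt K
  fun_prop

theorem abs_cutoff_sub_le (hδ : 0 < δ) (x y : E N) :
    |cutoff K δ x - cutoff K δ y| ≤ δ⁻¹ * ‖x - y‖ := by
  unfold cutoff
  refine (abs_max_sub_max_le_max _ _ _ _).trans ?_
  rw [sub_self, abs_zero]
  refine max_le (by positivity) ?_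
  have h := (Metric.lipschitz_infDist_pt K).dist_le_mul x y
  rw [Real.dist_eq, NNReal.coe_one, one_mul, dist_eq_norm] at h
  rw [show 1 - Metric.infDist x K / δ - (1 - Metric.infDist y K / δ) =
    -(δ⁻¹ * (Metric.infDist x K - Metric.infDist y K)) by ring, abs_neg, abs_mul,
    abs_of_pos (inv_pos.2 hδ)]
  gcongr

theorem memW0_cutoff (hN : 1 ≤ N) {s p : ℝ} (hs0 : 0 < s) (hs1 : s < 1) (hp : 1 < p)
    {Ω : Set (E N)} (hK : IsCompact K) (hKn : K.Nonempty) (hδ : 0 < δ)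
    (hKΩ : Metric.cthickening δ K ⊆ Ω) : MemW0 Ω s p (cutoff K δ) := by
  have hc : IsCompact (Metric.cthickening δ K) := hK.cthickening
  exact ⟨memW_of_lipschitz hN hs0 hs1 hp (inv_nonneg.2 hδ.le) (abs_cutoff_sub_le hδ)
    continuous_cutoff cutoff_nonneg (cutoff_le_one hδ) hc.measurableSet hc.measure_lt_top
    fun x hx => cutoff_of_notMem_cthickening hδ hKn hx,
    Filter.Eventually.of_forall fun x hx =>
      cutoff_of_notMem_cthickening hδ hKn fun h => hx (hKΩ h)⟩

end Cutoff

/-! ### Change of sign and of representative -/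

section Invariance

variable {N : ℕ} {Ω : Set (E N)} {s p lam : ℝ} {h u u' : E N → ℝ}

theorem ae_prod_eq (huu : u =ᵐ[(volume : Measure (E N))] u') :
    ∀ᵐ z ∂((volume : Measure (E N)).prod volume), u z.1 = u' z.1 ∧ u z.2 = u' z.2 :=
  (Measure.quasiMeasurePreserving_fst.ae huu).and (Measure.quasiMeasurePreserving_snd.ae huu)

theorem MemW0.congr (hu : MemW0 Ω s p u) (huu : u =ᵐ[(volume : Measure (E N))] u') :
    MemW0 Ω s p u' := by
  refine ⟨⟨hu.1.1.ae_eq huu, hu.1.2.congr ?_⟩, ?_⟩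
  · filter_upwards [ae_prod_eq huu] with z hz
    simp only [gagliardoDensity, hz]
  · filter_upwards [hu.2, huu] with x hx hxu hxΩ
    rw [← hxu, hx hxΩ]

/-- Being an eigenfunction depends only on the class modulo null sets. -/
theorem IsEigenfunction.congr (hu : IsEigenfunction Ω s p h lam u)
    (huu : u =ᵐ[(volume : Measure (E N))] u') : IsEigenfunction Ω s p h lam u' := by
  obtain ⟨⟨hW, ⟨hd1, C, hd2⟩, heq⟩, hne⟩ := hu
  have hae : ∀ v : E N → ℝ,
      (fun x => lam * h x * (|u x| ^ (p - 2) * u x) * v x) =ᵐ[volume.restrict Ω]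
        fun x => lam * h x * (|u' x| ^ (p - 2) * u' x) * v x := fun v => by
    filter_upwards [ae_restrict_of_ae huu] with x hx
    rw [hx]
  refine ⟨⟨hW.congr huu, ⟨fun v hv => (hd1 v hv).congr (hae v), C, fun v hv => ?_⟩,
    fun v hv => ?_⟩, fun h0 => hne (huu.trans h0)⟩
  · rw [← integral_congr_ae (hae v)]
    exact hd2 v hv
  · rw [← integral_congr_ae (hae v), ← heq v hv]
    refine integral_congr_ae ?_
    filter_upwards [ae_prod_eq huu] with z hz
    simp only [hz]

theorem IsEigenfunction.neg (hu : IsEigenfunction Ω s p h lam u) :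
    IsEigenfunction Ω s p h lam (fun x => -u x) := by
  obtain ⟨⟨hW, ⟨hd1, C, hd2⟩, heq⟩, hne⟩ := hu
  have hfun : ∀ v : E N → ℝ, (fun x => lam * h x * (|-u x| ^ (p - 2) * -u x) * v x) =
      fun x => -(lam * h x * (|u x| ^ (p - 2) * u x) * v x) := fun v => by
    funext x; rw [abs_neg]; ring
  have hW' : MemW0 Ω s p (fun x => -u x) := by
    simpa only [neg_one_mul] using hW.const_mul (-1)
  refine ⟨⟨hW', ⟨fun v hv => ?_, C, fun v hv => ?_⟩, fun v hv => ?_⟩, fun h0 => hne ?_⟩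
  · simp only [hfun v]; exact (hd1 v hv).neg
  · simp only [hfun v]; rw [integral_neg, abs_neg]; exact hd2 v hv
  · simp only [hfun v]; rw [integral_neg, ← heq v hv, pairingA, pairingA, ← integral_neg]
    congr 1; funext z
    rw [← neg_sub' (u z.1), abs_neg]; ring
  · filter_upwards [h0] with x hx
    simpa using hx

end Invariance

/-! ### Local integrability of the weight -/

section Weight

variable {N : ℕ} {Ω : Set (E N)} {s p q : ℝ} {h : E N → ℝ}

/-- A weight in `W̃_q` is integrable on compact subsets of `Ω`, where `ρ` is bounded below by a
positive constant. -/
theorem MemWTilde.integrableOn_isCompact (hN : 1 ≤ N) (hs0 : 0 < s) (hΩo : IsOpen Ω)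
    (hΩb : Bornology.IsBounded Ω) (hh : MemWTilde Ω s p q h) {K : Set (E N)} (hK : IsCompact K)
    (hKΩ : K ⊆ Ω) : IntegrableOn h K volume := by
  rcases K.eq_empty_or_nonempty with rfl | hKn
  · exact integrableOn_empty
  have : Nonempty (Fin N) := ⟨⟨0, hN⟩⟩
  obtain ⟨hm, a, r, ha0, -, hr, -, hLp⟩ := hh
  -- Without a boundary point `rho Ω` would be the junk value `0`.
  have hfr : (frontier Ω).Nonempty := by
    refine nonempty_frontier_iff.2 ⟨hKn.mono hKΩ, fun hu => ?_⟩
    rw [hu] at hΩb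
    exact NormedSpace.unbounded_univ ℝ (E N) hΩb
  obtain ⟨x₀, hx₀, hmin⟩ := hK.exists_isMinOn hKn
    (Metric.continuous_infDist_pt (frontier Ω)).continuousOn
  have hpos : 0 < Metric.infDist x₀ (frontier Ω) :=
    (isClosed_frontier.notMem_iff_infDist_pos hfr).1 fun hx =>
      (hΩo.frontier_eq ▸ hx).2 (hKΩ hx₀)
  set c := Metric.infDist x₀ (frontier Ω)
  have hle : volume.restrict K ≤ volume.restrict Ω := Measure.restrict_mono_set _ hKΩ
  have : IsFiniteMeasure ((volume : Measure (E N)).restrict K) :=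
    ⟨by rw [Measure.restrict_apply_univ]; exact hK.measure_lt_top⟩
  have hI : Integrable (fun x => h x * rho Ω x ^ (s * a)) (volume.restrict K) :=
    (hLp.mono_measure hle).integrable (by
      rw [← ENNReal.ofReal_one]; exact ENNReal.ofReal_le_ofReal hr.le)
  refine (hI.norm.const_mul (c ^ (s * a))⁻¹).mono' (hm.mono_measure hle).aestronglyMeasurable ?_
  refine (ae_restrict_iff' hK.measurableSet).2 (Filter.Eventually.of_forall fun x hx => ?_)
  have hcx : c ≤ rho Ω x := hmin hx
  have hca : 0 < c ^ (s * a) := Real.rpow_pos_of_pos hpos _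
  have h2 : c ^ (s * a) ≤ rho Ω x ^ (s * a) := by gcongr
  rw [norm_mul, Real.norm_of_nonneg (hca.le.trans h2), inv_mul_eq_div, le_div_iff₀ hca]
  gcongr

end Weight

/-! ### Nonnegative eigenfunctions -/

section Eigenfunctions

variable {N : ℕ} {Ω : Set (E N)} {s p lam : ℝ} {h u : E N → ℝ}

/-- The equation for a nonnegative eigenfunction `u` tested with `w ^ p / (u + ε) ^ (p - 1)`. -/
theorem IsEigenfunction.integral_pairingDensity (hp : 1 < p)
    (hu : IsEigenfunction Ω s p h lam u) (hu0 : ∀ x, 0 ≤ u x) {w : E N → ℝ}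
    (hw : MemW0 Ω s p w) (hw0 : ∀ x, 0 ≤ w x) {k : ℝ} (hwk : ∀ x, w x ≤ k) {ε : ℝ}
    (hε : 0 < ε) :
    ∫ z, pairingDensity s p u (fun x => w x ^ p / (u x + ε) ^ (p - 1)) z
        ∂((volume : Measure (E N)).prod volume) =
      ∫ x in Ω, lam * (h x * ((u x / (u x + ε)) ^ (p - 1) * w x ^ p)) := by
  refine (hu.1.2.2 _ (memW0_rpow_div hp hε hu.1.1.1 hu0 hw hw0 hwk)).trans ?_
  congr 1; funext x
  beta_reduce
  rw [abs_rpow_sub_two_mul hp (hu0 x), Real.div_rpow (hu0 x) (add_nonneg (hu0 x) hε.le)]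
  ring

theorem div_add_rpow_le_one (hp : 1 < p) {t ε : ℝ} (ht : 0 ≤ t) (hε : 0 < ε) :
    (t / (t + ε)) ^ (p - 1) ≤ 1 :=
  Real.rpow_le_one (by positivity) (div_le_one_of_le₀ (by linarith) (by positivity)) (by linarith)

/-- Strong maximum principle: a nonnegative eigenfunction is positive almost everywhere in `Ω`.
If both `{u = 0}` and `{u > d}` had positive measure, compact subsets `A`, `B` of them would make
the pairing of `u` with `η ^ p / (u + ε) ^ (p - 1)`, where the cutoff `η` is `1` on `A ∪ B`, tend
to `-∞` as `ε → 0`, by the contribution of `A × B`; the right-hand side of the equation stays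
bounded. Connectedness of `Ω` plays no role because of the nonlocality. -/
theorem IsEigenfunction.ae_pos (hN : 1 ≤ N) (hs0 : 0 < s) (hs1 : s < 1) (hp : 1 < p)
    (hΩo : IsOpen Ω)
    (hloc : ∀ K : Set (E N), IsCompact K → K ⊆ Ω → IntegrableOn h K volume)
    (hu : IsEigenfunction Ω s p h lam u) (hum : Measurable u) (hu0 : ∀ x, 0 ≤ u x) :
    ∀ᵐ x ∂(volume : Measure (E N)).restrict Ω, 0 < u x := by
  rw [ae_restrict_iff' hΩo.measurableSet, ae_iff]
  by_contra hZ
  have hZm : MeasurableSet {x | ¬(x ∈ Ω → 0 < u x)} := by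
    have : {x | ¬(x ∈ Ω → 0 < u x)} = Ω ∩ {x | 0 < u x}ᶜ := by
      ext x; simp [Classical.not_imp]
    rw [this]
    exact hΩo.measurableSet.inter (measurableSet_lt measurable_const hum).compl
  obtain ⟨A, hAZ, hAc, hA⟩ := hZm.exists_lt_isCompact (pos_iff_ne_zero.2 hZ)
  have hA0 : ∀ x ∈ A, x ∈ Ω ∧ u x = 0 := fun x hx => by
    obtain ⟨h1, h2⟩ := Classical.not_imp.1 (hAZ hx)
    exact ⟨h1, le_antisymm (not_lt.1 h2) (hu0 x)⟩
  obtain ⟨n, hn⟩ : ∃ n : ℕ, volume (Ω ∩ {x | 1 / ((n : ℝ) + 1) < u x}) ≠ 0 := by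
    by_contra! hcon
    refine hu.2 ?_
    have hnull := measure_iUnion_null hcon
    filter_upwards [hu.1.1.2, measure_eq_zero_iff_ae_notMem.1 hnull] with x hx hx'
    by_cases hxΩ : x ∈ Ω
    · refine le_antisymm (not_lt.1 fun hpos => hx' ?_) (hu0 x)
      obtain ⟨n, hn⟩ := exists_nat_one_div_lt hpos
      exact Set.mem_iUnion.2 ⟨n, hxΩ, hn⟩
    · exact hx hxΩ
  set d : ℝ := 1 / ((n : ℝ) + 1) with hd
  have hd0 : 0 < d := by positivity
  obtain ⟨B, hBP, hBc, hB⟩ := (hΩo.measurableSet.inter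
    (measurableSet_lt measurable_const hum)).exists_lt_isCompact (pos_iff_ne_zero.2 hn)
  have hABc : IsCompact (A ∪ B) := hAc.union hBc
  have hABn : (A ∪ B).Nonempty := (nonempty_of_measure_ne_zero hA.ne').mono Set.subset_union_left
  have hABΩ : A ∪ B ⊆ Ω := Set.union_subset (fun x hx => (hA0 x hx).1) fun x hx => (hBP hx).1
  obtain ⟨δ, hδ, hδΩ⟩ := hABc.exists_cthickening_subset_open hΩo hABΩ
  set η := cutoff (A ∪ B) δ with hη
  have hηW : MemW0 Ω s p η := memW0_cutoff hN hs0 hs1 hp hABc hABn hδ hδΩ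
  set C := Metric.cthickening δ (A ∪ B) with hC
  have hCc : IsCompact C := hABc.cthickening
  set M : ℝ := ∫ x in Ω, C.indicator (fun x => |lam * h x|) x with hM
  set G : ℝ := ∫ z, gagliardoDensity s p η z ∂((volume : Measure (E N)).prod volume) with hG
  -- The right-hand side of the tested equation is bounded uniformly in `ε`.
  have hlow : ∀ ε : ℝ, 0 < ε →
      -M ≤ ∫ z, pairingDensity s p u (fun x => η x ^ p / (u x + ε) ^ (p - 1)) z
        ∂((volume : Measure (E N)).prod volume) := fun ε hε => by
    rw [hu.integral_pairingDensity hp hu0 hηW cutoff_nonneg (cutoff_le_one hδ) hε]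
    have hb : Integrable (C.indicator fun x => |lam * h x|) (volume.restrict Ω) :=
      ((integrable_indicator_iff hCc.measurableSet).2
        ((hloc C hCc hδΩ).const_mul lam).abs).restrict
    refine neg_le_of_abs_le ((Real.norm_eq_abs _).symm.trans_le
      (norm_integral_le_of_norm_le hb (Filter.Eventually.of_forall fun x => ?_)))
    have h1 := div_add_rpow_le_one hp (hu0 x) hε
    have h1' : 0 ≤ (u x / (u x + ε)) ^ (p - 1) := by have := hu0 x; positivity
    by_cases hx : x ∈ C
    · rw [Set.indicator_of_mem hx, ← mul_assoc, norm_mul, Real.norm_eq_abs, Real.norm_eq_abs]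
      have h2 : η x ^ p ≤ 1 :=
        Real.rpow_le_one (cutoff_nonneg x) (cutoff_le_one hδ x) (by linarith)
      have h2' : 0 ≤ η x ^ p := Real.rpow_nonneg (cutoff_nonneg x) p
      refine mul_le_of_le_one_right (abs_nonneg _) ?_
      rw [abs_of_nonneg (mul_nonneg h1' h2')]
      exact mul_le_one₀ h1 h2' h2
    · rw [Set.indicator_of_notMem hx, hη, cutoff_of_notMem_cthickening hδ hABn hx,
        Real.zero_rpow (by linarith)]
      simp
  obtain ⟨D, hD1, hD⟩ : ∃ D : ℝ, 0 < D ∧ ∀ x ∈ A, ∀ y ∈ B, ‖x - y‖ ≤ D := by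
    obtain ⟨D, hD⟩ := Metric.isBounded_iff.1 hABc.isBounded
    exact ⟨max D 1, by positivity, fun x hx y hy => by
      rw [← dist_eq_norm]; exact (hD (Or.inl hx) (Or.inr hy)).trans (le_max_left _ _)⟩
  have hNsp : 0 < (N : ℝ) + s * p := by positivity
  have hDp : 0 < D ^ ((N : ℝ) + s * p) := Real.rpow_pos_of_pos hD1 _
  set m : ℝ := ((volume : Measure (E N)).prod volume).real (A ×ˢ B) with hm
  have hm0 : 0 < m := by
    rw [hm, measureReal_def, Measure.prod_prod, ENNReal.toReal_mul]
    exact mul_pos (ENNReal.toReal_pos hA.ne' hAc.measure_lt_top.ne)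
      (ENNReal.toReal_pos hB.ne' hBc.measure_lt_top.ne)
  have hABm : MeasurableSet (A ×ˢ B) := hAc.measurableSet.prod hBc.measurableSet
  have hABf : ((volume : Measure (E N)).prod volume) (A ×ˢ B) ≠ ∞ :=
    (hAc.prod hBc).measure_lt_top.ne
  -- The contribution of `A × B` to the pairing is at most `-c * m`, and `c → ∞` as `ε → 0`.
  have hupp : ∀ ε : ℝ, 0 < ε → ε ≤ d →
      -M ≤ G - d ^ (p - 1) * (ε ^ (-(p - 1)) - d ^ (-(p - 1))) / D ^ ((N : ℝ) + s * p) * m := by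
    intro ε hε hεd
    set c := d ^ (p - 1) * (ε ^ (-(p - 1)) - d ^ (-(p - 1))) / D ^ ((N : ℝ) + s * p) with hc
    refine (hlow ε hε).trans ?_
    have hind : Integrable ((A ×ˢ B).indicator fun _ => c)
        ((volume : Measure (E N)).prod volume) :=
      (integrable_indicator_iff hABm).2 (integrableOn_const hABf)
    have htest := memW0_rpow_div hp hε hu.1.1.1 hu0 hηW cutoff_nonneg (cutoff_le_one hδ)
    have hmono := integral_mono (integrable_pairingDensity hp hu.1.1.1 htest.1)
      (hηW.1.2.sub hind) (fun z => ?_)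
    · simp only [Pi.sub_apply] at hmono
      rw [integral_sub hηW.1.2 hind, integral_indicator_const c hABm, smul_eq_mul] at hmono
      rw [mul_comm c]
      exact hmono
    · rw [Pi.sub_apply]
      by_cases hz : z ∈ A ×ˢ B
      · rw [Set.indicator_of_mem hz]
        obtain ⟨hz1, hz2⟩ := hz
        have hη1 : η z.1 = 1 := cutoff_of_mem (Or.inl hz1)
        have hη2 : η z.2 = 1 := cutoff_of_mem (Or.inr hz2)
        have hu1 : u z.1 = 0 := (hA0 _ hz1).2
        have hu2 : d < u z.2 := (hBP hz2).2
        have hu2' : 0 < u z.2 := hd0.trans hu2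
        have hG0 : 0 ≤ gagliardoDensity s p η z := gagliardoDensity_nonneg z
        have hne : 0 < ‖z.1 - z.2‖ := norm_pos_iff.2 (sub_ne_zero.2 fun heq => by
          rw [← heq, hu1] at hu2'; exact lt_irrefl _ hu2')
        have hden : ‖z.1 - z.2‖ ^ ((N : ℝ) + s * p) ≤ D ^ ((N : ℝ) + s * p) := by
          have := hD _ hz1 _ hz2; gcongr
        have hval : pairingDensity s p u (fun x => η x ^ p / (u x + ε) ^ (p - 1)) z =
            -(u z.2 ^ (p - 1) * (ε ^ (-(p - 1)) - (u z.2 + ε) ^ (-(p - 1))) /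
              ‖z.1 - z.2‖ ^ ((N : ℝ) + s * p)) := by
          simp only [pairingDensity, hη1, hη2, hu1, Real.one_rpow, zero_sub, zero_add, abs_neg]
          rw [← abs_rpow_sub_two_mul hp hu2'.le, Real.rpow_neg hε.le,
            Real.rpow_neg (by positivity)]
          ring
        have hbase : (u z.2 + ε) ^ (-(p - 1)) ≤ d ^ (-(p - 1)) :=
          Real.rpow_le_rpow_of_nonpos hd0 (by linarith) (by linarith)
        have hdε : d ^ (-(p - 1)) ≤ ε ^ (-(p - 1)) :=
          Real.rpow_le_rpow_of_nonpos hε hεd (by linarith)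
        have hcle : c ≤ u z.2 ^ (p - 1) * (ε ^ (-(p - 1)) - (u z.2 + ε) ^ (-(p - 1))) /
              ‖z.1 - z.2‖ ^ ((N : ℝ) + s * p) := by
          rw [hc]
          refine div_le_div₀ (mul_nonneg (by positivity) (by linarith)) ?_ (by positivity) hden
          refine mul_le_mul ?_ (by linarith) (by linarith) (by positivity)
          exact Real.rpow_le_rpow hd0.le hu2.le (by linarith)
        rw [hval]
        linarith
      · rw [Set.indicator_of_notMem hz, sub_zero]
        exact pairingDensity_picone_le hp hε hu0 cutoff_nonneg z
  have htend := tendsto_rpow_neg_nhdsGT_zero (y := -(p - 1)) (by linarith)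
  obtain ⟨ε, hεR, hε0, hεd⟩ := ((htend.eventually_gt_atTop
    ((G + M) / m * D ^ ((N : ℝ) + s * p) / d ^ (p - 1) + d ^ (-(p - 1)))).and
      (Ioc_mem_nhdsGT hd0)).exists
  have hfin := hupp ε hε0 hεd
  have hdp : 0 < d ^ (p - 1) := Real.rpow_pos_of_pos hd0 _
  rw [← lt_sub_iff_add_lt, div_lt_iff₀ hdp, ← lt_div_iff₀ hDp, div_lt_iff₀ hm0,
    mul_comm _ (d ^ (p - 1))] at hεR
  linarith

/-- Some member of `W_0^{s,p}(Ω)` satisfies `∫_Ω h |w| ^ p = 1`: cutoffs of a compact subset `K`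
of `{h > 0}` give `∫_Ω h |w| ^ p` close to `∫_K h > 0`. -/
theorem exists_integral_weight_eq_one (hN : 1 ≤ N) (hs0 : 0 < s) (hs1 : s < 1) (hp : 1 < p)
    (hΩo : IsOpen Ω) (hhm : AEMeasurable h (volume.restrict Ω))
    (hloc : ∀ K : Set (E N), IsCompact K → K ⊆ Ω → IntegrableOn h K volume)
    (hpos : 0 < volume {x | x ∈ Ω ∧ 0 < h x}) :
    ∃ w : E N → ℝ, MemW0 Ω s p w ∧ ∫ x in Ω, h x * |w x| ^ p = 1 := by
  have hA : 0 < volume (Ω ∩ {x | 0 < hhm.mk h x}) := by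
    have h1 : volume {x | x ∈ Ω ∧ 0 < h x} ≤ volume (Ω ∩ {x | 0 < hhm.mk h x}) := by
      refine measure_mono_ae ?_
      filter_upwards [(ae_restrict_iff' hΩo.measurableSet).1 hhm.ae_eq_mk] with x hx hx'
      exact ⟨hx'.1, show 0 < hhm.mk h x from hx hx'.1 ▸ hx'.2⟩
    exact hpos.trans_le h1
  obtain ⟨K, hKA, hKc, hK⟩ := (hΩo.measurableSet.inter
    (measurableSet_lt measurable_const hhm.measurable_mk)).exists_lt_isCompact hA
  have hKΩ : K ⊆ Ω := fun x hx => (hKA hx).1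
  have hKn : K.Nonempty := nonempty_of_measure_ne_zero hK.ne'
  obtain ⟨δ, hδ, hδΩ⟩ := hKc.exists_cthickening_subset_open hΩo hKΩ
  set C := Metric.cthickening δ K with hC
  have hCc : IsCompact C := hKc.cthickening
  have hδn : ∀ n : ℕ, 0 < δ / ((n : ℝ) + 1) := fun n => by positivity
  have hsub : ∀ n : ℕ, Metric.cthickening (δ / ((n : ℝ) + 1)) K ⊆ C := fun n =>
    Metric.cthickening_mono (div_le_self hδ.le (by linarith [n.cast_nonneg (α := ℝ)])) K
  have htend : Filter.Tendsto
      (fun n : ℕ => ∫ x in Ω, h x * |cutoff K (δ / ((n : ℝ) + 1)) x| ^ p) Filter.atTop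
      (nhds (∫ x in Ω, K.indicator h x)) := by
    refine tendsto_integral_of_dominated_convergence (C.indicator fun x => |h x|)
      (fun n => ?_) ?_ (fun n => ?_) ?_
    · exact (hhm.mul ((continuous_cutoff.measurable.aemeasurable.abs).pow_const
        p)).aestronglyMeasurable
    · exact ((integrable_indicator_iff hCc.measurableSet).2 (hloc C hCc hδΩ).abs).restrict
    · refine Filter.Eventually.of_forall fun x => ?_
      rw [abs_of_nonneg (cutoff_nonneg x)]
      by_cases hx : x ∈ C
      · rw [Set.indicator_of_mem hx, norm_mul, Real.norm_eq_abs,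
          Real.norm_of_nonneg (Real.rpow_nonneg (cutoff_nonneg x) p)]
        exact mul_le_of_le_one_right (abs_nonneg _)
          (Real.rpow_le_one (cutoff_nonneg x) (cutoff_le_one (hδn n) x) (by linarith))
      · rw [Set.indicator_of_notMem hx,
          cutoff_of_notMem_cthickening (hδn n) hKn fun hx' => hx (hsub n hx'),
          Real.zero_rpow (by linarith), mul_zero, norm_zero]
    · refine Filter.Eventually.of_forall fun x => ?_
      refine tendsto_const_nhds.congr' ?_
      by_cases hx : x ∈ K
      · refine Filter.Eventually.of_forall fun n => ?_
        beta_reduce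
        rw [Set.indicator_of_mem hx, cutoff_of_mem hx, abs_one, Real.one_rpow, mul_one]
      · have hdist : 0 < Metric.infDist x K :=
          (hKc.isClosed.notMem_iff_infDist_pos hKn).1 hx
        obtain ⟨n₀, hn₀⟩ := exists_nat_gt (δ / Metric.infDist x K)
        filter_upwards [Filter.eventually_ge_atTop n₀] with n hn
        have hnn : (n₀ : ℝ) ≤ n := by exact_mod_cast hn
        have hle : 1 ≤ Metric.infDist x K / (δ / ((n : ℝ) + 1)) := by
          rw [one_le_div (hδn n), div_le_iff₀ (by positivity)]
          rw [div_lt_iff₀ hdist] at hn₀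
          nlinarith
        rw [Set.indicator_of_notMem hx, cutoff, max_eq_left (by linarith), abs_zero,
          Real.zero_rpow (by linarith), mul_zero]
  have hlim : 0 < ∫ x in Ω, K.indicator h x := by
    rw [integral_indicator hKc.measurableSet, Measure.restrict_restrict hKc.measurableSet,
      Set.inter_eq_left.2 hKΩ]
    have haepos : ∀ᵐ x ∂(volume : Measure (E N)).restrict K, 0 < h x := by
      filter_upwards [ae_restrict_of_ae_restrict_of_subset hKΩ hhm.ae_eq_mk,
        ae_restrict_mem hKc.measurableSet] with x hx hxK
      rw [hx]; exact (hKA hxK).2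
    rw [integral_pos_iff_support_of_nonneg_ae (haepos.mono fun x hx => hx.le) (hloc K hKc hKΩ)]
    have hsupp : (volume.restrict K) (Function.support h)ᶜ = 0 :=
      measure_eq_zero_iff_ae_notMem.2 (haepos.mono fun x hx hx' => hx' hx.ne')
    rw [measure_of_measure_compl_eq_zero hsupp, Measure.restrict_apply_univ]
    exact hK
  obtain ⟨n, hn⟩ := (htend.eventually (lt_mem_nhds hlim)).exists
  set c := ∫ x in Ω, h x * |cutoff K (δ / ((n : ℝ) + 1)) x| ^ p with hc
  refine ⟨fun x => c ^ (-p⁻¹) * cutoff K (δ / ((n : ℝ) + 1)) x,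
    (memW0_cutoff hN hs0 hs1 hp hKc hKn (hδn n) ((hsub n).trans hδΩ)).const_mul _, ?_⟩
  have hcp : |c ^ (-p⁻¹)| ^ p = c⁻¹ := by
    rw [abs_of_pos (Real.rpow_pos_of_pos hn _), ← Real.rpow_mul hn.le, neg_mul,
      inv_mul_cancel₀ (by linarith), Real.rpow_neg_one]
  have : ∀ x, h x * |c ^ (-p⁻¹) * cutoff K (δ / ((n : ℝ) + 1)) x| ^ p =
      c⁻¹ * (h x * |cutoff K (δ / ((n : ℝ) + 1)) x| ^ p) := fun x => by
    rw [abs_mul, Real.mul_rpow (abs_nonneg _) (abs_nonneg _), hcp]; ring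
  simp only [this]
  rw [integral_const_mul, ← hc, inv_mul_cancel₀ hn.ne']

/-- The Barta-type bound: a nonnegative eigenfunction forces its eigenvalue not to exceed the
energy of any normalized competitor `w`. The test functions are
`w_n ^ p / (u + 1 / (n + 1)) ^ (p - 1)`; the truncation `w_n = min |w| n` puts them into
`W_0^{s,p}(Ω)`. -/
theorem IsEigenfunction.le_energy (hp : 1 < p)
    (hhm : AEMeasurable h (volume.restrict Ω))
    (hu : IsEigenfunction Ω s p h lam u) (hu0 : ∀ x, 0 ≤ u x)
    (hupos : ∀ᵐ x ∂(volume : Measure (E N)).restrict Ω, 0 < u x) {w : E N → ℝ}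
    (hw : MemW0 Ω s p w) (hw1 : ∫ x in Ω, h x * |w x| ^ p = 1) :
    lam ≤ gagliardoNorm s p w ^ p := by
  rw [gagliardoNorm_rpow hp]
  -- A non-integrable function would have integral `0`.
  have hint : Integrable (fun x => h x * |w x| ^ p) (volume.restrict Ω) := by
    by_contra hni
    rw [integral_undef hni] at hw1
    exact zero_ne_one hw1
  have hε : ∀ n : ℕ, 0 < 1 / ((n : ℝ) + 1) := fun n => by positivity
  have hum : AEMeasurable u (volume.restrict Ω) := hu.1.1.1.1.1.aemeasurable.restrict
  have hwm : AEMeasurable w (volume.restrict Ω) := hw.1.1.1.aemeasurable.restrict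
  have hmin0 : ∀ (n : ℕ) x, 0 ≤ min |w x| (n : ℝ) := fun n x => by positivity
  have htend : Filter.Tendsto (fun n : ℕ => ∫ x in Ω, lam * (h x *
      ((u x / (u x + 1 / ((n : ℝ) + 1))) ^ (p - 1) * min |w x| (n : ℝ) ^ p))) Filter.atTop
      (nhds (∫ x in Ω, lam * (h x * |w x| ^ p))) := by
    refine tendsto_integral_of_dominated_convergence (fun x => |lam * (h x * |w x| ^ p)|)
      (fun n => ?_) (hint.const_mul lam).abs (fun n => ?_) ?_
    · exact ((hhm.mul (((hum.div (hum.add_const _)).pow_const _).mul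
        ((hwm.abs.min aemeasurable_const).pow_const p))).const_mul lam).aestronglyMeasurable
    · refine Filter.Eventually.of_forall fun x => ?_
      have h1 := div_add_rpow_le_one hp (hu0 x) (hε n)
      have h1' : 0 ≤ (u x / (u x + 1 / ((n : ℝ) + 1))) ^ (p - 1) := by
        have := hu0 x; positivity
      have h2 : min |w x| (n : ℝ) ^ p ≤ |w x| ^ p := by gcongr; exact min_le_left _ _
      have h2' : 0 ≤ min |w x| (n : ℝ) ^ p := Real.rpow_nonneg (hmin0 n x) p
      have h3 : (u x / (u x + 1 / ((n : ℝ) + 1))) ^ (p - 1) * min |w x| (n : ℝ) ^ p ≤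
          |w x| ^ p := (mul_le_of_le_one_left h2' h1).trans h2
      rw [Real.norm_eq_abs, ← mul_assoc, ← mul_assoc lam, abs_mul, abs_mul (lam * h x) (|w x| ^ p),
        abs_of_nonneg (mul_nonneg h1' h2'), abs_of_nonneg (h2'.trans h2)]
      gcongr
    · filter_upwards [hupos] with x hx
      refine Filter.Tendsto.const_mul lam (Filter.Tendsto.const_mul (h x) ?_)
      have hA : Filter.Tendsto (fun n : ℕ => (u x / (u x + 1 / ((n : ℝ) + 1))) ^ (p - 1))
          Filter.atTop (nhds ((u x / (u x + 0)) ^ (p - 1))) := by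
        refine Filter.Tendsto.rpow_const ?_ (Or.inr (by linarith))
        exact tendsto_const_nhds.div
          (tendsto_const_nhds.add tendsto_one_div_add_atTop_nhds_zero_nat) (by linarith)
      rw [add_zero, div_self hx.ne', Real.one_rpow] at hA
      have hB : Filter.Tendsto (fun n : ℕ => min |w x| (n : ℝ) ^ p) Filter.atTop
          (nhds (|w x| ^ p)) := by
        refine tendsto_const_nhds.congr' ?_
        filter_upwards [tendsto_natCast_atTop_atTop.eventually_ge_atTop |w x|] with n hn
        rw [min_eq_left hn]
      simpa only [one_mul] using hA.mul hB
  rw [integral_const_mul, hw1, mul_one] at htend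
  refine le_of_tendsto' htend fun n => ?_
  obtain ⟨hwn, hle⟩ := hw.min_abs hp (k := (n : ℝ)) n.cast_nonneg
  rw [← hu.integral_pairingDensity hp hu0 hwn (hmin0 n) (fun x => min_le_right _ _) (hε n)]
  refine le_trans (integral_mono (integrable_pairingDensity hp hu.1.1.1
    (memW0_rpow_div hp (hε n) hu.1.1.1 hu0 hwn (hmin0 n) fun x => min_le_right _ _).1)
    hwn.1.2 fun z => pairingDensity_picone_le hp (hε n) hu0 (hmin0 n) z) hle

/-- The eigenvalue of an eigenfunction that is nonnegative in `Ω` does not exceed `λ₁`. -/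
theorem IsEigenfunction.le_lambda1_of_nonneg (hN : 1 ≤ N) (hs0 : 0 < s) (hs1 : s < 1)
    (hp : 1 < p) (hΩo : IsOpen Ω) (hΩb : Bornology.IsBounded Ω) (hh : MemWTilde Ω s p p h)
    (hpos : 0 < volume {x | x ∈ Ω ∧ 0 < h x}) (hu : IsEigenfunction Ω s p h lam u)
    (hu0 : ∀ᵐ x ∂(volume : Measure (E N)).restrict Ω, 0 ≤ u x) : lam ≤ lambda1 Ω s p h := by
  have hloc : ∀ K : Set (E N), IsCompact K → K ⊆ Ω → IntegrableOn h K volume :=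
    fun K hK hKΩ => hh.integrableOn_isCompact hN hs0 hΩo hΩb hK hKΩ
  have hum : AEMeasurable u volume := hu.1.1.1.1.1.aemeasurable
  -- A Borel representative that is nonnegative everywhere.
  have hae : u =ᵐ[volume] fun x => max (hum.mk u x) 0 := by
    filter_upwards [hum.ae_eq_mk, hu.1.1.2, (ae_restrict_iff' hΩo.measurableSet).1 hu0]
      with x h1 h2 h3
    rw [← h1, max_eq_left]
    by_cases hx : x ∈ Ω
    · exact h3 hx
    · exact (h2 hx).ge
  have hu' := hu.congr hae
  have hu0' : ∀ x, 0 ≤ max (hum.mk u x) 0 := fun x => le_max_right _ _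
  have hupos := hu'.ae_pos hN hs0 hs1 hp hΩo hloc (hum.measurable_mk.max measurable_const) hu0'
  obtain ⟨w, hw, hw1⟩ := exists_integral_weight_eq_one hN hs0 hs1 hp hΩo hh.1 hloc hpos
  -- If no competitor existed, `lambda1` would be the junk value `sInf ∅ = 0`.
  refine le_csInf ⟨_, w, hw, hw1, rfl⟩ ?_
  rintro t ⟨v, hv, hv1, rfl⟩
  exact hu'.le_energy hp hh.1 hu0' hupos hv hv1

end Eigenfunctions

end FracPLap

theorem corollary3p7 (N : ℕ) (hN : 1 ≤ N) (s p : ℝ) (hs0 : 0 < s) (hs1 : s < 1) (hp : 1 < p)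
    (Ω : Set (FracPLap.E N)) (hΩo : IsOpen Ω) (hΩb : Bornology.IsBounded Ω)
    (h : FracPLap.E N → ℝ) (hh : FracPLap.MemWTilde Ω s p p h)
    (hpos : 0 < MeasureTheory.volume {x | x ∈ Ω ∧ 0 < h x})
    (lam : ℝ) (hlam : FracPLap.IsEigenvalue Ω s p h lam) (hgt : FracPLap.lambda1 Ω s p h < lam)
    (u : FracPLap.E N → ℝ) (hu : FracPLap.IsEigenfunction Ω s p h lam u) :
    FracPLap.SignChanging Ω u := by
  refine ⟨fun hzero => hgt.not_ge ?_, fun hzero => hgt.not_ge ?_⟩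
  · refine hu.neg.le_lambda1_of_nonneg hN hs0 hs1 hp hΩo hΩb hh hpos ?_
    filter_upwards [hzero] with x hx
    exact neg_nonneg.2 (max_eq_right_iff.1 hx)
  · refine hu.le_lambda1_of_nonneg hN hs0 hs1 hp hΩo hΩb hh hpos ?_
    filter_upwards [hzero] with x hx
    exact neg_nonpos.1 (max_eq_right_iff.1 hx)
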